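/- **Setting.** Let $p,n>2$. Let $(T,h)$ and $(M,\varphi)$ be smooth semi-Riemannian manifolds of dimensions $p$ and $n$, let $J^1(T,M)$ be the 1-jet space with induced local coordinates $(t^\alpha,x^i,x^i_\alpha)$ over coordinate domains of $T$ and $M$, and let $\sigma$ be a smooth function on $J^1(T,M)$. Let $H^\gamma_{\alpha\beta}$ and $\gamma^k_{ij}$ be the Christoffel symbols of $h_{\alpha\beta}(t)$ and $\varphi_{ij}(x)$, and use the nonlinear connection $M^{(i)}_{(\alpha)\beta}=-H^\mu_{\alpha\beta}x^i_\mu$, $N^{(i)}_{(\alpha)j}=\gamma^i_{jm}x^m_\alpha$, with adapted frame $(X_A)$: $$\frac{\delta}{\delta t^\alpha}=\frac{\partial}{\partial t^\alpha}-M^{(j)}_{(\beta)\alpha}\frac{\partial}{\partial x^j_\beta},\qquad \frac{\delta}{\delta x^i}=\frac{\partial}{\partial x^i}-N^{(j)}_{(\beta)i}\frac{\partial}{\partial x^j_\beta},\qquad \frac{\partial}{\partial x^i_\alpha},$$ and dual coframe $(dt^\alpha,dx^i,\delta x^i_\alpha)$. Put $$G=h_{\alpha\beta}\,dt^\alpha\otimes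 dt^\beta+e^{2\sigma}\varphi_{ij}\,dx^i\otimes dx^j+h^{\alpha\beta}e^{2\sigma}\varphi_{ij}\,\delta x^i_\alpha\otimes\delta x^j_\beta .$$ With $\sigma_\gamma=\frac{\delta\sigma}{\delta t^\gamma}$, $\sigma_k=\frac{\delta\sigma}{\delta x^k}$, $\sigma^{(\gamma)}_{(k)}=\frac{\partial\sigma}{\partial x^k_\gamma}$, the Cartan canonical connection $C\Gamma$ is the $h$-normal connection with adapted coefficients $H^\gamma_{\alpha\beta}$, $G^k_{j\gamma}=\sigma_\gamma\delta^k_j$, $L^k_{ij}=\gamma^k_{ij}+\sigma_i\delta^k_j+\sigma_j\delta^k_i-\varphi_{ij}\varphi^{km}\sigma_m$ and $C^{i(\gamma)}_{j(k)}=\sigma^{(\gamma)}_{(k)}\delta^i_j+\sigma^{(\gamma)}_{(j)}\delta^i_k-\varphi_{jk}\varphi^{im}\sigma^{(\gamma)}_{(m)}$. That is, $\nabla_{\delta/\delta t^\gamma}$ acts on temporal indices through $H$ and on spatial indices through $G$, and $\nabla_{\delta/\delta x^k}$, $\nabla_{\partial/\partial x^k_\gamma}$ act on spatial indices through $L$,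 $C$ and trivially on temporal ones; in a vertical pair $\binom{(i)}{(\alpha)}$ each of the two indices is treated accordingly, so $\frac{\partial}{\partial x^i_\alpha}$ transforms like $\frac{\delta}{\delta x^i}\otimes dt^\alpha$. The corresponding local covariant derivatives are denoted ${}_{/\gamma}$, ${}_{|k}$, $|^{(\gamma)}_{(k)}$. Define $R^D_{ABC}$ by $\mathbf R(X_C,X_B)X_A=R^D_{ABC}X_D$, where $\mathbf R$ is the curvature of $C\Gamma$; $R_{AB}=R^D_{ABD}$; $Sc=G^{AB}R_{AB}$. Write $R_{i\beta}$, $P^{(\alpha)}_{(i)\beta}$, $P^{(\alpha)}_{(i)j}$, $P^{\ (\alpha)}_{i(j)}$ for the mixed components of $R_{AB}$ (first index first), with first indices raised by $G^{-1}$ in $R^m_\beta$, $P^{(m)}_{(\mu)\beta}$, $P^{(m)}_{(\mu)j}$, $P^{m(\alpha)}_{\ (i)}$. Let $H$, $R$, $S$ be the contributions to $Sc$ of the temporal, spatial and vertical blocks, so $Sc=H+R+S$. **Theorem.** Let $\mathcal K\neq0$ be a constant and let the d-tensor $\mathcal T$ satisfy the Einstein equations $R_{AB}-\frac{Sc}{2}G_{AB}=\mathcal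 K\mathcal T_{AB}$ and the conservation laws $\mathcal T^B_{A|B}=0$ for every $A$, where $\mathcal T^B_A=G^{BD}\mathcal T_{DA}$. Put $$\tilde{\mathcal T}_{\alpha\beta}=\mathcal T_{\alpha\beta}+\tfrac{R+S}{2\mathcal K}h_{\alpha\beta},\quad \tilde{\mathcal T}_{ij}=\mathcal T_{ij}+\tfrac{H+S}{2\mathcal K}e^{2\sigma}\varphi_{ij},\quad \tilde{\mathcal T}^{(\alpha)(\beta)}_{(i)(j)}=\mathcal T^{(\alpha)(\beta)}_{(i)(j)}+\tfrac{H+R}{2\mathcal K}h^{\alpha\beta}e^{2\sigma}\varphi_{ij},$$ let $\tilde{\mathcal T}_T$, $\tilde{\mathcal T}_M$, $\tilde{\mathcal T}_v$ be the traces of these three blocks with respect to the corresponding blocks of $G$, and raise first indices with $G^{-1}$. Then $$\tilde{\mathcal T}^\mu_{\beta/\mu}+\frac1{n-2}\tilde{\mathcal T}_{M/\beta}+\frac1{pn-2}\tilde{\mathcal T}_{v/\beta}=\frac1{\mathcal K}\Big(-R^m_{\beta|m}-P^{(m)}_{(\mu)\beta}|^{(\mu)}_{(m)}\Big),$$ $$\frac1{p-2}\tilde{\mathcal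 T}_{T|j}+\tilde{\mathcal T}^m_{j|m}+\frac1{pn-2}\tilde{\mathcal T}_{v|j}=-\frac1{\mathcal K}P^{(m)}_{(\mu)j}|^{(\mu)}_{(m)},$$ $$\frac1{p-2}\tilde{\mathcal T}_T|^{(\alpha)}_{(i)}+\frac1{n-2}\tilde{\mathcal T}_M|^{(\alpha)}_{(i)}+\tilde{\mathcal T}^{(m)(\alpha)}_{(\mu)(i)}|^{(\mu)}_{(m)}=-\frac1{\mathcal K}P^{m(\alpha)}_{\ (i)|m}$$ for all $\beta$, $j$, $i$, $\alpha$, at every point. -/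

import Mathlib

open scoped ContDiff BigOperators

noncomputable section

/-- Indices of the adapted frame on `J¹(T, M)`, `dim T = p`, `dim M = n`: temporal indices `α`,
spatial indices `i`, and vertical index pairs `(i, α)` (the direction of `x^i_α`). -/
abbrev AIdx (p n : ℕ) : Type := Fin p ⊕ Fin n ⊕ (Fin n × Fin p)

/-- The temporal index `α`. -/
abbrev tI {p n : ℕ} (α : Fin p) : AIdx p n := .inl α

/-- The spatial index `i`. -/
abbrev xI {p n : ℕ} (i : Fin n) : AIdx p n := .inr (.inl i)

/-- The vertical index pair `(i, α)`. -/
abbrev vI {p n : ℕ} (i : Fin n) (α : Fin p) : AIdx p n := .inr (.inr (i, α))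

/-- Induced local coordinates `(t^α, x^i, x^i_α)` on the 1-jet space;
for `z : JetPt p n`, `z.1 α = t^α`, `z.2.1 i = x^i` and `z.2.2 i α = x^i_α`. -/
abbrev JetPt (p n : ℕ) : Type := (Fin p → ℝ) × (Fin n → ℝ) × (Fin n → Fin p → ℝ)

/-- Kronecker delta. -/
def kron {ι : Type} [DecidableEq ι] (a b : ι) : ℝ := if a = b then 1 else 0

/-- The partial derivative `∂f/∂y^k` of a function on `ℝ^m`. -/
def partialD {m : ℕ} (k : Fin m) (f : (Fin m → ℝ) → ℝ) (y : Fin m → ℝ) : ℝ :=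
  fderiv ℝ f y (Pi.single k 1)

/-- The Christoffel symbols `Γ^k_{ij}` of a metric `g` on (an open subset of) `ℝ^m`. -/
def christoffel {m : ℕ} (g : (Fin m → ℝ) → Matrix (Fin m) (Fin m) ℝ) (k i j : Fin m)
    (y : Fin m → ℝ) : ℝ :=
  (1 / 2) * ∑ l, (g y)⁻¹ k l *
    (partialD i (fun w => g w l j) y + partialD j (fun w => g w l i) y
      - partialD l (fun w => g w i j) y)

/-- A smooth semi-Riemannian metric on `U ⊆ ℝ^m`, given by its matrix of components. -/
structure IsSemiRiemannianOn {m : ℕ} (g : (Fin m → ℝ) → Matrix (Fin m) (Fin m) ℝ)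
    (U : Set (Fin m → ℝ)) : Prop where
  smooth : ∀ i j, ContDiffOn ℝ ∞ (fun y => g y i j) U
  symm : ∀ y ∈ U, (g y).IsSymm
  nondeg : ∀ y ∈ U, (g y).det ≠ 0

/-- The data of the space `GRGML^n_p` in induced local coordinates: coordinate domains `U` of `T`
and `V` of `M`, the semi-Riemannian metrics `h_{αβ}(t)` and `φ_{ij}(x)`, and the smooth conformal
function `σ(t, x, x^i_α)` on the part of `J¹(T, M)` lying over `U × V`. -/
structure GRGML (p n : ℕ) where
  U : Set (Fin p → ℝ)
  V : Set (Fin n → ℝ)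
  isOpen_U : IsOpen U
  isOpen_V : IsOpen V
  h : (Fin p → ℝ) → Matrix (Fin p) (Fin p) ℝ
  φ : (Fin n → ℝ) → Matrix (Fin n) (Fin n) ℝ
  metric_h : IsSemiRiemannianOn h U
  metric_φ : IsSemiRiemannianOn φ V
  σ : JetPt p n → ℝ
  smooth_σ : ContDiffOn ℝ ∞ σ (U ×ˢ V ×ˢ Set.univ)

namespace GRGML

variable {p n : ℕ} (S : GRGML p n)

/-- The coordinate domain of `J¹(T, M)` over `U × V`. -/
def dom : Set (JetPt p n) := S.U ×ˢ S.V ×ˢ Set.univ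

/-- Temporal components `M^{(i)}_{(α)β} = -H^μ_{αβ} x^i_μ` of the nonlinear connection. -/
def nlM (i : Fin n) (α β : Fin p) (z : JetPt p n) : ℝ :=
  -∑ μ, christoffel S.h μ α β z.1 * z.2.2 i μ

/-- Spatial components `N^{(i)}_{(α)j} = γ^i_{jm} x^m_α` of the nonlinear connection. -/
def nlN (i : Fin n) (α : Fin p) (j : Fin n) (z : JetPt p n) : ℝ :=
  ∑ m, christoffel S.φ i j m z.2.1 * z.2.2 m α

/-- The adapted frame `X_A`: `δ/δt^α = ∂/∂t^α - M^{(j)}_{(β)α} ∂/∂x^j_β`,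
`δ/δx^i = ∂/∂x^i - N^{(j)}_{(β)i} ∂/∂x^j_β`, and `∂/∂x^i_α`. -/
def frame : AIdx p n → JetPt p n → JetPt p n
  | .inl α => fun z => (Pi.single α 1, 0, fun j β => -S.nlM j β α z)
  | .inr (.inl i) => fun z => (0, Pi.single i 1, fun j β => -S.nlN j β i z)
  | .inr (.inr (i, α)) => fun _ => (0, 0, Pi.single i (Pi.single α 1))

/-- The adapted coframe `dt^α`, `dx^i`, `δx^i_α = dx^i_α + M^{(i)}_{(α)β} dt^β + N^{(i)}_{(α)j} dx^j`,
evaluated at the point `z` on the tangent vector `v`. -/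
def coframe (z v : JetPt p n) : AIdx p n → ℝ
  | .inl α => v.1 α
  | .inr (.inl i) => v.2.1 i
  | .inr (.inr (i, α)) =>
      v.2.2 i α + ∑ β, S.nlM i α β z * v.1 β + ∑ j, S.nlN i α j z * v.2.1 j

/-- The derivative `X_A f` of a function along the adapted frame. It is also the local covariant
derivative of a scalar: `f_{/β}`, `f_{|j}` and `f|^{(α)}_{(i)}` for `A = tI β`, `xI j`, `vI i α`. -/
def D (A : AIdx p n) (f : JetPt p n → ℝ) (z : JetPt p n) : ℝ :=
  fderiv ℝ f z (S.frame A z)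

/-- `σ_γ = δσ/δt^γ`. -/
def σt (γ : Fin p) : JetPt p n → ℝ := S.D (tI γ) S.σ

/-- `σ_k = δσ/δx^k`. -/
def σx (k : Fin n) : JetPt p n → ℝ := S.D (xI k) S.σ

/-- `σ^{(γ)}_{(k)} = ∂σ/∂x^k_γ`. -/
def σv (k : Fin n) (γ : Fin p) : JetPt p n → ℝ := S.D (vI k γ) S.σ

/-- `L^k_{ij} = γ^k_{ij} + Λ^k_{ij}` with
`Λ^k_{ij} = σ_i δ^k_j + σ_j δ^k_i - φ_{ij} φ^{km} σ_m`. -/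
def Lc (k i j : Fin n) (z : JetPt p n) : ℝ :=
  christoffel S.φ k i j z.2.1 + (S.σx i z * kron k j + S.σx j z * kron k i
    - S.φ z.2.1 i j * ∑ m, (S.φ z.2.1)⁻¹ k m * S.σx m z)

/-- `C^{i(γ)}_{j(k)} = σ^{(γ)}_{(k)} δ^i_j + σ^{(γ)}_{(j)} δ^i_k - φ_{jk} φ^{im} σ^{(γ)}_{(m)}`. -/
def Cc (i j k : Fin n) (γ : Fin p) (z : JetPt p n) : ℝ :=
  S.σv k γ z * kron i j + S.σv j γ z * kron i k
    - S.φ z.2.1 j k * ∑ m, (S.φ z.2.1)⁻¹ i m * S.σv m γ z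

/-- The Cartan canonical connection, the `h`-normal connection with adapted coefficients
`(H^γ_{αβ}, G^k_{jγ} = σ_γ δ^k_j, L^k_{ij}, C^{i(γ)}_{j(k)})`, by its coefficients
in the adapted frame: `∇_{X_B} X_A = ∑ D, (conn D A B) X_D`. On the vertical fields `∂/∂x^i_β`,
the index `i` is transported as that of `δ/δx^i` and the index `β` as that of `dt^β`. -/
def conn : AIdx p n → AIdx p n → AIdx p n → JetPt p n → ℝ
  | .inl α, .inl β, .inl γ => fun z => christoffel S.h α β γ z.1
  | .inr (.inl k), .inr (.inl j), .inl γ => fun z => S.σt γ z * kron k j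
  | .inr (.inl k), .inr (.inl i), .inr (.inl j) => S.Lc k i j
  | .inr (.inl i), .inr (.inl j), .inr (.inr (k, γ)) => S.Cc i j k γ
  | .inr (.inr (k, α)), .inr (.inr (i, β)), .inl γ => fun z =>
      kron β α * (S.σt γ z * kron k i) - kron k i * christoffel S.h β α γ z.1
  | .inr (.inr (k, α)), .inr (.inr (i, β)), .inr (.inl j) => fun z => kron β α * S.Lc k i j z
  | .inr (.inr (k, α)), .inr (.inr (i, β)), .inr (.inr (j, γ)) => fun z =>
      kron β α * S.Cc k i j γ z
  | _, _, _ => fun _ => 0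

/-- The components `[X_C, X_B]^E` of the Lie brackets of the adapted frame. -/
def bracket (E C B : AIdx p n) (z : JetPt p n) : ℝ :=
  S.coframe z (VectorField.lieBracket ℝ (S.frame C) (S.frame B) z) E

/-- The curvature components `R^D_{ABC}`, defined by `R(X_C, X_B) X_A = R^D_{ABC} X_D`, where
`R(X, Y) Z = ∇_X ∇_Y Z - ∇_Y ∇_X Z - ∇_{[X, Y]} Z`. -/
def curv (D A B C : AIdx p n) (z : JetPt p n) : ℝ :=
  S.D C (S.conn D A B) z - S.D B (S.conn D A C) z
    + ∑ E, (S.conn E A B z * S.conn D E C z - S.conn E A C z * S.conn D E B z)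
    - ∑ E, S.bracket E C B z * S.conn D A E z

/-- The Ricci d-tensor `R_{AB} = R^D_{ABD}`. -/
def Ric (z : JetPt p n) (A B : AIdx p n) : ℝ := ∑ D, S.curv D A B D z

/-- The gravitational `h`-potential
`G = h_{αβ} dt^α dt^β + e^{2σ} φ_{ij} dx^i dx^j + h^{αβ} e^{2σ} φ_{ij} δx^i_α δx^j_β`. -/
def G (z : JetPt p n) : AIdx p n → AIdx p n → ℝ
  | .inl α, .inl β => S.h z.1 α β
  | .inr (.inl i), .inr (.inl j) => Real.exp (2 * S.σ z) * S.φ z.2.1 i j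
  | .inr (.inr (i, α)), .inr (.inr (j, β)) =>
      (S.h z.1)⁻¹ α β * Real.exp (2 * S.σ z) * S.φ z.2.1 i j
  | _, _ => 0

/-- The inverse `G^{AB}` of the `h`-potential. -/
def Ginv (z : JetPt p n) : AIdx p n → AIdx p n → ℝ
  | .inl α, .inl β => (S.h z.1)⁻¹ α β
  | .inr (.inl i), .inr (.inl j) => Real.exp (-2 * S.σ z) * (S.φ z.2.1)⁻¹ i j
  | .inr (.inr (i, α)), .inr (.inr (j, β)) =>
      S.h z.1 α β * Real.exp (-2 * S.σ z) * (S.φ z.2.1)⁻¹ i j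
  | _, _ => 0

/-- The scalar curvature `Sc = G^{AB} R_{AB}`. -/
def Sc (z : JetPt p n) : ℝ := ∑ A, ∑ B, S.Ginv z A B * S.Ric z A B

/-- The temporal trace `h^{αβ} W_{αβ}` of a d-tensor `W_{AB}`. -/
def trT (W : JetPt p n → AIdx p n → AIdx p n → ℝ) (z : JetPt p n) : ℝ :=
  ∑ α, ∑ β, (S.h z.1)⁻¹ α β * W z (tI α) (tI β)

/-- The spatial trace `e^{-2σ} φ^{ij} W_{ij}`. -/
def trM (W : JetPt p n → AIdx p n → AIdx p n → ℝ) (z : JetPt p n) : ℝ :=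
  ∑ i, ∑ j, Real.exp (-2 * S.σ z) * (S.φ z.2.1)⁻¹ i j * W z (xI i) (xI j)

/-- The vertical trace `h_{αβ} e^{-2σ} φ^{ij} W^{(α)(β)}_{(i)(j)}`. -/
def trV (W : JetPt p n → AIdx p n → AIdx p n → ℝ) (z : JetPt p n) : ℝ :=
  ∑ i, ∑ α, ∑ j, ∑ β,
    S.h z.1 α β * Real.exp (-2 * S.σ z) * (S.φ z.2.1)⁻¹ i j * W z (vI i α) (vI j β)

/-- Raising the first index: `W^B_A = G^{BD} W_{DA}`; `raise W z B A` is `W^B_A` at `z`. -/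
def raise (W : JetPt p n → AIdx p n → AIdx p n → ℝ) (z : JetPt p n) (B A : AIdx p n) : ℝ :=
  ∑ D, S.Ginv z B D * W z D A

/-- The component `(∇_{X_C} W)^B_A` of the covariant derivative of a (1,1) d-tensor `W^B_A` with
respect to the Cartan connection: `W^B_{A/γ}`, `W^B_{A|k}` and `W^B_A|^{(γ)}_{(k)}`
for `C = tI γ`, `xI k` and `vI k γ` respectively. -/
def cov (W : JetPt p n → AIdx p n → AIdx p n → ℝ) (C B A : AIdx p n) (z : JetPt p n) : ℝ :=
  S.D C (fun w => W w B A) z + ∑ E, S.conn B E C z * W z E A - ∑ E, S.conn E A C z * W z B E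

/-- The Einstein equations `Ric - (Sc / 2) G = K 𝒯`. -/
def Einstein (K : ℝ) (𝒯 : JetPt p n → AIdx p n → AIdx p n → ℝ) : Prop :=
  ∀ z ∈ S.dom, ∀ A B, S.Ric z A B - S.Sc z / 2 * S.G z A B = K * 𝒯 z A B

/-- The conservation laws `𝒯^B_{A|B} = 0` for all `A`. -/
def Conserved (𝒯 : JetPt p n → AIdx p n → AIdx p n → ℝ) : Prop :=
  ∀ z ∈ S.dom, ∀ A, ∑ B, S.cov (S.raise 𝒯) B B A z = 0

/-- The new stress-energy d-tensor `𝒯̃`, with `H`, `R`, `S` the temporal, spatial and vertical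
traces of the Ricci d-tensor:
`𝒯̃_{αβ} = 𝒯_{αβ} + (R + S) / (2 K) h_{αβ}`,
`𝒯̃_{ij} = 𝒯_{ij} + (H + S) / (2 K) e^{2σ} φ_{ij}`,
`𝒯̃^{(α)(β)}_{(i)(j)} = 𝒯^{(α)(β)}_{(i)(j)} + (H + R) / (2 K) h^{αβ} e^{2σ} φ_{ij}`;
the mixed components are those of `𝒯`. -/
def newT (K : ℝ) (𝒯 : JetPt p n → AIdx p n → AIdx p n → ℝ) (z : JetPt p n) :
    AIdx p n → AIdx p n → ℝ
  | .inl α, .inl β => 𝒯 z (tI α) (tI β)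
      + (S.trM S.Ric z + S.trV S.Ric z) / (2 * K) * S.h z.1 α β
  | .inr (.inl i), .inr (.inl j) => 𝒯 z (xI i) (xI j)
      + (S.trT S.Ric z + S.trV S.Ric z) / (2 * K) * (Real.exp (2 * S.σ z) * S.φ z.2.1 i j)
  | .inr (.inr (i, α)), .inr (.inr (j, β)) => 𝒯 z (vI i α) (vI j β)
      + (S.trT S.Ric z + S.trM S.Ric z) / (2 * K)
        * ((S.h z.1)⁻¹ α β * Real.exp (2 * S.σ z) * S.φ z.2.1 i j)
  | A, B => 𝒯 z A B

end GRGML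

end

/-! By the Einstein equations, 𝒯 = (Ric − (Sc/2) G)/K. Passing to 𝒯̃ adds to each diagonal block of
𝒯 a scalar (`shift`) times the same block of G, so after raising an index it adds that scalar times
the identity of the block. The Cartan connection preserves the three blocks, hence these identities
are parallel, and the divergence of a diagonal block changes only by the gradient of the scalar
(`cov_of_eq`, `Einstein.cov_newT`).

The traces of the blocks of G are p, n and pn, so the traces of 𝒯̃ are −(p−2)/(2K) H, −(n−2)/(2K) R
and −(pn−2)/(2K) S (`Einstein.trT_newT`, `Einstein.trM_newT`, `Einstein.trV_newT`). Divided by p−2,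
n−2 and pn−2, their gradients cancel exactly the gradients of the added scalars. What remains on the
left is the divergence of a diagonal block of 𝒯, which conservation turns into minus the divergences
of the mixed blocks. There G vanishes, so 𝒯 = Ric/K (`Einstein.cov_mixed`).

The second and third identities contain no term from the temporal row because R_{αB} = 0 for
non-temporal B (`Ric_temporal_eq_zero`). Neither Bianchi identities nor metric compatibility enter.
The smoothness lemmas are needed because the frame derivative is an `fderiv`, additive only on
differentiable functions. -/

/-! ### Smoothness of inverse matrices and Christoffel symbols. -/

theorem ContDiffOn.matrix_det {E : Type*} [NormedAddCommGroup E] [NormedSpace ℝ E] {m : ℕ}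
    {g : E → Matrix (Fin m) (Fin m) ℝ} {U : Set E}
    (hg : ∀ i j, ContDiffOn ℝ ∞ (fun y => g y i j) U) :
    ContDiffOn ℝ ∞ (fun y => (g y).det) U := by
  simp only [Matrix.det_apply']
  exact ContDiffOn.sum fun τ _ => contDiffOn_const.mul (contDiffOn_prod fun i _ => hg _ _)

theorem ContDiffOn.matrix_inv_apply {E : Type*} [NormedAddCommGroup E] [NormedSpace ℝ E] {m : ℕ}
    {g : E → Matrix (Fin m) (Fin m) ℝ} {U : Set E}
    (hg : ∀ i j, ContDiffOn ℝ ∞ (fun y => g y i j) U) (h0 : ∀ y ∈ U, (g y).det ≠ 0)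
    (i j : Fin m) : ContDiffOn ℝ ∞ (fun y => (g y)⁻¹ i j) U := by
  simp only [Matrix.inv_def, Matrix.smul_apply, smul_eq_mul, Ring.inverse_eq_inv',
    Matrix.adjugate_apply]
  -- Cramer's rule: an adjugate entry is the determinant of g with row j replaced by a basis vector,
  -- so each entry of that matrix is constant or an entry of g.
  refine ((ContDiffOn.matrix_det hg).inv h0).mul (ContDiffOn.matrix_det fun k l => ?_)
  by_cases hk : k = j
  · subst hk
    simpa using contDiffOn_const
  · simpa [Matrix.updateRow_ne hk] using hg k l

theorem IsSemiRiemannianOn.contDiffOn_christoffel {m : ℕ}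
    {g : (Fin m → ℝ) → Matrix (Fin m) (Fin m) ℝ} {U : Set (Fin m → ℝ)} (hU : IsOpen U)
    (hg : IsSemiRiemannianOn g U) (k i j : Fin m) :
    ContDiffOn ℝ ∞ (christoffel g k i j) U := by
  have hp : ∀ l a b, ContDiffOn ℝ ∞ (partialD l (fun w => g w a b)) U := fun l a b =>
    ((hg.smooth a b).fderiv_of_isOpen hU (by simp)).clm_apply contDiffOn_const
  exact contDiffOn_const.mul (ContDiffOn.sum fun l _ =>
    (ContDiffOn.matrix_inv_apply hg.smooth hg.nondeg k l).mul
      (((hp _ _ _).add (hp _ _ _)).sub (hp _ _ _)))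

namespace GRGML

variable {p n : ℕ} (S : GRGML p n)

theorem isOpen_dom : IsOpen S.dom := S.isOpen_U.prod (S.isOpen_V.prod isOpen_univ)

variable {S} in
theorem dom_U {z : JetPt p n} (hz : z ∈ S.dom) : z.1 ∈ S.U := hz.1

variable {S} in
theorem dom_V {z : JetPt p n} (hz : z ∈ S.dom) : z.2.1 ∈ S.V := hz.2.1

/-! ### Smoothness of the geometric objects -/

theorem contDiffOn_comp_t {f : (Fin p → ℝ) → ℝ} (hf : ContDiffOn ℝ ∞ f S.U) :
    ContDiffOn ℝ ∞ (fun z : JetPt p n => f z.1) S.dom :=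
  hf.comp contDiff_fst.contDiffOn fun _ hz => dom_U hz

theorem contDiffOn_comp_x {f : (Fin n → ℝ) → ℝ} (hf : ContDiffOn ℝ ∞ f S.V) :
    ContDiffOn ℝ ∞ (fun z : JetPt p n => f z.2.1) S.dom :=
  hf.comp (contDiff_fst.comp contDiff_snd).contDiffOn fun _ hz => dom_V hz

theorem contDiffOn_h (α β : Fin p) :
    ContDiffOn ℝ ∞ (fun z : JetPt p n => S.h z.1 α β) S.dom :=
  S.contDiffOn_comp_t (S.metric_h.smooth α β)

theorem contDiffOn_h_inv (α β : Fin p) :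
    ContDiffOn ℝ ∞ (fun z : JetPt p n => (S.h z.1)⁻¹ α β) S.dom :=
  S.contDiffOn_comp_t (f := fun t => (S.h t)⁻¹ α β)
    (ContDiffOn.matrix_inv_apply S.metric_h.smooth S.metric_h.nondeg α β)

theorem contDiffOn_φ (i j : Fin n) :
    ContDiffOn ℝ ∞ (fun z : JetPt p n => S.φ z.2.1 i j) S.dom :=
  S.contDiffOn_comp_x (S.metric_φ.smooth i j)

theorem contDiffOn_φ_inv (i j : Fin n) :
    ContDiffOn ℝ ∞ (fun z : JetPt p n => (S.φ z.2.1)⁻¹ i j) S.dom :=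
  S.contDiffOn_comp_x (f := fun t => (S.φ t)⁻¹ i j)
    (ContDiffOn.matrix_inv_apply S.metric_φ.smooth S.metric_φ.nondeg i j)

theorem contDiffOn_christoffel_h (α β γ : Fin p) :
    ContDiffOn ℝ ∞ (fun z : JetPt p n => christoffel S.h α β γ z.1) S.dom :=
  S.contDiffOn_comp_t (S.metric_h.contDiffOn_christoffel S.isOpen_U α β γ)

theorem contDiffOn_christoffel_φ (i j k : Fin n) :
    ContDiffOn ℝ ∞ (fun z : JetPt p n => christoffel S.φ i j k z.2.1) S.dom :=
  S.contDiffOn_comp_x (S.metric_φ.contDiffOn_christoffel S.isOpen_V i j k)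

theorem contDiff_jet (i : Fin n) (α : Fin p) : ContDiff ℝ ∞ (fun z : JetPt p n => z.2.2 i α) := by
  fun_prop

theorem contDiffOn_nlM (i : Fin n) (α β : Fin p) : ContDiffOn ℝ ∞ (S.nlM i α β) S.dom :=
  (ContDiffOn.sum fun μ _ =>
    (S.contDiffOn_christoffel_h μ α β).mul (contDiff_jet i μ).contDiffOn).neg

theorem contDiffOn_nlN (i : Fin n) (α : Fin p) (j : Fin n) :
    ContDiffOn ℝ ∞ (S.nlN i α j) S.dom :=
  ContDiffOn.sum fun m _ =>
    (S.contDiffOn_christoffel_φ i j m).mul (contDiff_jet m α).contDiffOn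

theorem contDiffOn_frame (A : AIdx p n) : ContDiffOn ℝ ∞ (S.frame A) S.dom := by
  rcases A with α | i | ⟨i, α⟩
  · exact contDiffOn_const.prodMk (contDiffOn_const.prodMk
      (contDiffOn_pi.2 fun j => contDiffOn_pi.2 fun β => (S.contDiffOn_nlM j β α).neg))
  · exact contDiffOn_const.prodMk (contDiffOn_const.prodMk
      (contDiffOn_pi.2 fun j => contDiffOn_pi.2 fun β => (S.contDiffOn_nlN j β i).neg))
  · exact contDiffOn_const

theorem contDiffOn_D {f : JetPt p n → ℝ} (hf : ContDiffOn ℝ ∞ f S.dom) (A : AIdx p n) :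
    ContDiffOn ℝ ∞ (S.D A f) S.dom :=
  (hf.fderiv_of_isOpen S.isOpen_dom (by simp)).clm_apply (S.contDiffOn_frame A)

theorem contDiffOn_σx (k : Fin n) : ContDiffOn ℝ ∞ (S.σx k) S.dom := S.contDiffOn_D S.smooth_σ _

theorem contDiffOn_σv (k : Fin n) (γ : Fin p) : ContDiffOn ℝ ∞ (S.σv k γ) S.dom :=
  S.contDiffOn_D S.smooth_σ _

theorem contDiffOn_Lc (k i j : Fin n) : ContDiffOn ℝ ∞ (S.Lc k i j) S.dom :=
  (S.contDiffOn_christoffel_φ k i j).add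
    ((((S.contDiffOn_σx i).mul contDiffOn_const).add ((S.contDiffOn_σx j).mul contDiffOn_const)).sub
      ((S.contDiffOn_φ i j).mul
        (ContDiffOn.sum fun m _ => (S.contDiffOn_φ_inv k m).mul (S.contDiffOn_σx m))))

theorem contDiffOn_Cc (i j k : Fin n) (γ : Fin p) : ContDiffOn ℝ ∞ (S.Cc i j k γ) S.dom :=
  (((S.contDiffOn_σv k γ).mul contDiffOn_const).add
    ((S.contDiffOn_σv j γ).mul contDiffOn_const)).sub
      ((S.contDiffOn_φ j k).mul
        (ContDiffOn.sum fun m _ => (S.contDiffOn_φ_inv i m).mul (S.contDiffOn_σv m γ)))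

theorem contDiffOn_conn (A B C : AIdx p n) : ContDiffOn ℝ ∞ (S.conn A B C) S.dom := by
  have ht : ∀ γ, ContDiffOn ℝ ∞ (S.σt γ) S.dom := fun γ => S.contDiffOn_D S.smooth_σ _
  rcases A with α | k | ⟨k, α⟩ <;> rcases B with β | i | ⟨i, β⟩ <;> rcases C with γ | j | ⟨j, γ⟩
  all_goals first
    | exact contDiffOn_const
    | exact S.contDiffOn_christoffel_h _ _ _
    | exact (ht _).mul contDiffOn_const
    | exact S.contDiffOn_Lc _ _ _
    | exact S.contDiffOn_Cc _ _ _ _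
    | exact contDiffOn_const.mul (S.contDiffOn_Lc _ _ _)
    | exact contDiffOn_const.mul (S.contDiffOn_Cc _ _ _ _)
    | exact (contDiffOn_const.mul ((ht _).mul contDiffOn_const)).sub
        (contDiffOn_const.mul (S.contDiffOn_christoffel_h _ _ _))

theorem contDiffOn_coframe {v : JetPt p n → JetPt p n} (hv : ContDiffOn ℝ ∞ v S.dom)
    (A : AIdx p n) : ContDiffOn ℝ ∞ (fun z => S.coframe z (v z) A) S.dom := by
  have h1 : ∀ β, ContDiffOn ℝ ∞ (fun z => (v z).1 β) S.dom := contDiffOn_pi.1 hv.fst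
  have h2 : ∀ j, ContDiffOn ℝ ∞ (fun z => (v z).2.1 j) S.dom := contDiffOn_pi.1 hv.snd.fst
  have h3 : ∀ i α, ContDiffOn ℝ ∞ (fun z => (v z).2.2 i α) S.dom := fun i =>
    contDiffOn_pi.1 (contDiffOn_pi.1 hv.snd.snd i)
  rcases A with α | i | ⟨i, α⟩
  · exact h1 α
  · exact h2 i
  · exact ((h3 i α).add (ContDiffOn.sum fun β _ => (S.contDiffOn_nlM i α β).mul (h1 β))).add
      (ContDiffOn.sum fun j _ => (S.contDiffOn_nlN i α j).mul (h2 j))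

theorem contDiffOn_bracket (E C B : AIdx p n) : ContDiffOn ℝ ∞ (S.bracket E C B) S.dom := by
  have h : ∀ A, ContDiffOn ℝ ∞ (fun z => fderiv ℝ (S.frame A) z) S.dom := fun A =>
    (S.contDiffOn_frame A).fderiv_of_isOpen S.isOpen_dom (by simp)
  exact S.contDiffOn_coframe (((h B).clm_apply (S.contDiffOn_frame C)).sub
    ((h C).clm_apply (S.contDiffOn_frame B))) E

theorem contDiffOn_curv (D A B C : AIdx p n) : ContDiffOn ℝ ∞ (S.curv D A B C) S.dom :=
  (((S.contDiffOn_D (S.contDiffOn_conn D A B) C).sub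
    (S.contDiffOn_D (S.contDiffOn_conn D A C) B)).add
      (ContDiffOn.sum fun _ _ => ((S.contDiffOn_conn _ _ _).mul (S.contDiffOn_conn _ _ _)).sub
        ((S.contDiffOn_conn _ _ _).mul (S.contDiffOn_conn _ _ _)))).sub
    (ContDiffOn.sum fun _ _ => (S.contDiffOn_bracket _ _ _).mul (S.contDiffOn_conn _ _ _))

theorem contDiffOn_Ric (A B : AIdx p n) : ContDiffOn ℝ ∞ (fun z => S.Ric z A B) S.dom :=
  ContDiffOn.sum fun _ _ => S.contDiffOn_curv _ _ _ _

theorem contDiffOn_exp (c : ℝ) :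
    ContDiffOn ℝ ∞ (fun z => Real.exp (c * S.σ z)) S.dom :=
  (contDiffOn_const.mul S.smooth_σ).exp

theorem contDiffOn_G (A B : AIdx p n) : ContDiffOn ℝ ∞ (fun z => S.G z A B) S.dom := by
  rcases A with α | i | ⟨i, α⟩ <;> rcases B with β | j | ⟨j, β⟩
  all_goals first
    | exact contDiffOn_const
    | exact S.contDiffOn_h _ _
    | exact (S.contDiffOn_exp _).mul (S.contDiffOn_φ _ _)
    | exact ((S.contDiffOn_h_inv _ _).mul (S.contDiffOn_exp _)).mul (S.contDiffOn_φ _ _)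

theorem contDiffOn_Ginv (A B : AIdx p n) : ContDiffOn ℝ ∞ (fun z => S.Ginv z A B) S.dom := by
  rcases A with α | i | ⟨i, α⟩ <;> rcases B with β | j | ⟨j, β⟩
  all_goals first
    | exact contDiffOn_const
    | exact S.contDiffOn_h_inv _ _
    | exact (S.contDiffOn_exp _).mul (S.contDiffOn_φ_inv _ _)
    | exact ((S.contDiffOn_h _ _).mul (S.contDiffOn_exp _)).mul (S.contDiffOn_φ_inv _ _)

theorem contDiffOn_trT_Ric : ContDiffOn ℝ ∞ (S.trT S.Ric) S.dom :=
  ContDiffOn.sum fun _ _ => ContDiffOn.sum fun _ _ =>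
    (S.contDiffOn_h_inv _ _).mul (S.contDiffOn_Ric _ _)

theorem contDiffOn_trM_Ric : ContDiffOn ℝ ∞ (S.trM S.Ric) S.dom :=
  ContDiffOn.sum fun _ _ => ContDiffOn.sum fun _ _ =>
    ((S.contDiffOn_exp _).mul (S.contDiffOn_φ_inv _ _)).mul (S.contDiffOn_Ric _ _)

theorem contDiffOn_trV_Ric : ContDiffOn ℝ ∞ (S.trV S.Ric) S.dom :=
  ContDiffOn.sum fun _ _ => ContDiffOn.sum fun _ _ =>
    ContDiffOn.sum fun _ _ => ContDiffOn.sum fun _ _ =>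
      (((S.contDiffOn_h _ _).mul (S.contDiffOn_exp _)).mul (S.contDiffOn_φ_inv _ _)).mul
        (S.contDiffOn_Ric _ _)

theorem Sc_eq (z : JetPt p n) : S.Sc z = S.trT S.Ric z + S.trM S.Ric z + S.trV S.Ric z := by
  simp [Sc, Fintype.sum_sum_type, Fintype.sum_prod_type, Ginv, trT, trM, trV, add_assoc]

theorem differentiableAt_of_contDiffOn {S : GRGML p n} {F : Type*} [NormedAddCommGroup F]
    [NormedSpace ℝ F] {f : JetPt p n → F} (hf : ContDiffOn ℝ ∞ f S.dom) {z : JetPt p n}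
    (hz : z ∈ S.dom) : DifferentiableAt ℝ f z :=
  (hf.contDiffAt (S.isOpen_dom.mem_nhds hz)).differentiableAt (by simp)

/-! ### Block structure -/

/-- The block (temporal, spatial or vertical) of an index. -/
def block : AIdx p n → Fin 3
  | .inl _ => 0
  | .inr (.inl _) => 1
  | .inr (.inr _) => 2

theorem conn_eq_zero {A B : AIdx p n} (h : block A ≠ block B) (C : AIdx p n) (z : JetPt p n) :
    S.conn A B C z = 0 := by
  rcases A with α | k | ⟨k, α⟩ <;> rcases B with β | i | ⟨i, β⟩ <;> rcases C with γ | j | ⟨j, γ⟩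
  all_goals first
    | rfl
    | exact absurd rfl h

theorem G_eq_zero {A B : AIdx p n} (h : block A ≠ block B) (z : JetPt p n) : S.G z A B = 0 := by
  rcases A with α | k | ⟨k, α⟩ <;> rcases B with β | i | ⟨i, β⟩
  all_goals first
    | rfl
    | exact absurd rfl h

theorem Ginv_eq_zero {A B : AIdx p n} (h : block A ≠ block B) (z : JetPt p n) :
    S.Ginv z A B = 0 := by
  rcases A with α | k | ⟨k, α⟩ <;> rcases B with β | i | ⟨i, β⟩
  all_goals first
    | rfl
    | exact absurd rfl h

/-! ### The frame derivative -/

theorem D_congr {f g : JetPt p n → ℝ} (h : ∀ w ∈ S.dom, f w = g w) {z : JetPt p n}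
    (hz : z ∈ S.dom) (A : AIdx p n) : S.D A f z = S.D A g z := by
  have : f =ᶠ[nhds z] g := Filter.eventually_of_mem (S.isOpen_dom.mem_nhds hz) h
  rw [D, D, this.fderiv_eq]

/-- Differentiability is not needed: scaling by c ≠ 0 is invertible, so it respects even the junk
value of `fderiv`, and c = 0 gives a constant. -/
theorem D_const_mul (c : ℝ) (f : JetPt p n → ℝ) (A : AIdx p n) (z : JetPt p n) :
    S.D A (fun w => c * f w) z = c * S.D A f z := by
  rcases eq_or_ne c 0 with rfl | hc
  · simp [D]
  · have := invertibleOfNonzero hc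
    have h := fderiv_const_smul_of_invertible (𝕜 := ℝ) (f := f) (x := z) c
    rw [D, show (fun w => c * f w) = c • f from rfl, h]
    rfl

theorem D_add {f g : JetPt p n → ℝ} {z : JetPt p n} (hf : DifferentiableAt ℝ f z)
    (hg : DifferentiableAt ℝ g z) (A : AIdx p n) :
    S.D A (fun w => f w + g w) z = S.D A f z + S.D A g z := by
  simp only [D]
  rw [show (fun w => f w + g w) = f + g from rfl, fderiv_add hf hg]
  rfl

theorem D_const (c : ℝ) (A : AIdx p n) (z : JetPt p n) : S.D A (fun _ => c) z = 0 := by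
  simp [D]

theorem D_comp_fst {f : (Fin p → ℝ) → ℝ} {z : JetPt p n} (hf : DifferentiableAt ℝ f z.1)
    {A : AIdx p n} (hA : block A ≠ 0) : S.D A (fun w => f w.1) z = 0 := by
  have h : HasFDerivAt (fun w : JetPt p n => f w.1) _ z := hf.hasFDerivAt.comp z hasFDerivAt_fst
  rw [D, h.fderiv]
  rcases A with α | k | ⟨k, α⟩
  · exact absurd rfl hA
  · simp [frame]
  · simp [frame]

/-! ### Vanishing of the mixed temporal Ricci components -/

/-- Every frame field has a constant ∂/∂t part. Hence Lie brackets of frame fields have no temporal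
component. -/
theorem fderiv_frame_fst {z : JetPt p n} (hz : z ∈ S.dom) (A : AIdx p n) (v : JetPt p n) :
    (fderiv ℝ (S.frame A) z v).1 = 0 := by
  have h := (differentiableAt_of_contDiffOn (S.contDiffOn_frame A) hz).hasFDerivAt.fst
  have hc : ∃ c, (fun w => (S.frame A w).1) = fun _ => c := by
    rcases A with α | k | ⟨k, α⟩ <;> exact ⟨_, rfl⟩
  obtain ⟨c, hc⟩ := hc
  rw [hc] at h
  exact DFunLike.congr_fun (h.unique (hasFDerivAt_const c z)) v

theorem bracket_temporal {z : JetPt p n} (hz : z ∈ S.dom) (α : Fin p) (C B : AIdx p n) :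
    S.bracket (tI α) C B z = 0 := by
  have : (VectorField.lieBracket ℝ (S.frame C) (S.frame B) z).1 = 0 := by
    simp [VectorField.lieBracket, S.fderiv_frame_fst hz]
  exact congrFun this α

theorem conn_temporal (α β : Fin p) {B : AIdx p n} (hB : block B ≠ 0) :
    S.conn (tI α) (tI β) B = fun _ => 0 := by
  rcases B with γ | k | ⟨k, γ⟩
  · exact absurd rfl hB
  · rfl
  · rfl

/-- The connection acts on the temporal block as the Levi-Civita connection of h pulled back from T:
its coefficients depend on t alone and vanish in the spatial and vertical directions. Its curvature
therefore vanishes as soon as one of the two directions is not temporal. -/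
theorem Ric_temporal_eq_zero {z : JetPt p n} (hz : z ∈ S.dom) (α : Fin p) {B : AIdx p n}
    (hB : block B ≠ 0) : S.Ric z (tI α) B = 0 := by
  refine Finset.sum_eq_zero fun D _ => ?_
  rcases D with δ | D
  -- Temporal D: the only derivative that could survive is that of a Christoffel symbol of h along a
  -- direction that leaves t fixed. In the bracket sum, temporal E has zero bracket and other E a
  -- zero coefficient.
  · have h1 : S.D B (S.conn (tI δ) (tI α) (tI δ)) z = 0 :=
      S.D_comp_fst (((S.metric_h.contDiffOn_christoffel S.isOpen_U δ α δ).contDiffAt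
        (S.isOpen_U.mem_nhds (dom_U hz))).differentiableAt (by simp)) hB
    rw [curv, S.conn_temporal δ α hB, D_const, h1, Finset.sum_eq_zero, Finset.sum_eq_zero]
    · simp
    · rintro (ε | E) -
      · rw [S.bracket_temporal hz, zero_mul]
      · rcases E with k | ⟨k, γ⟩ <;> simp [conn]
    · rintro (ε | E) -
      · simp [S.conn_temporal _ _ hB]
      · rw [S.conn_eq_zero (A := .inr E) (B := tI α), S.conn_eq_zero (A := .inr E) (B := tI α)]
        · simp
        all_goals rcases E with k | ⟨k, γ⟩ <;> simp [block]
  -- Non-temporal D: R^D_{αBD} would map a temporal vector out of its block. In each quadratic term,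
  -- one of the two factors changes block.
  · have hD : block (Sum.inr D : AIdx p n) ≠ 0 := by rcases D with k | ⟨k, γ⟩ <;> simp [block]
    have h0 : ∀ C, S.conn (.inr D) (tI α) C = fun _ => 0 := fun C =>
      funext fun w => S.conn_eq_zero hD C w
    rw [curv, h0, h0, D_const, D_const, Finset.sum_eq_zero, Finset.sum_eq_zero]
    · simp
    · intro E _
      rw [congrFun (h0 E) z, mul_zero]
    · intro E _
      rcases eq_or_ne (block E) 0 with hE | hE
      · rw [S.conn_eq_zero (A := .inr D) (B := E), S.conn_eq_zero (A := .inr D) (B := E)]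
        · simp
        all_goals rwa [hE]
      · rw [S.conn_eq_zero (A := E) (B := tI α) hE, S.conn_eq_zero (A := E) (B := tI α) hE]
        simp

/-! ### Raising indices and the covariant derivative -/

theorem contDiffOn_raise {W : JetPt p n → AIdx p n → AIdx p n → ℝ}
    (hW : ∀ A B, ContDiffOn ℝ ∞ (fun z => W z A B) S.dom) (B A : AIdx p n) :
    ContDiffOn ℝ ∞ (fun z => S.raise W z B A) S.dom :=
  ContDiffOn.sum fun _ _ => (S.contDiffOn_Ginv _ _).mul (hW _ _)

/-- The covariant derivative of a component involves only components in the same pair of blocks,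
since the connection is block diagonal, and the Kronecker delta is parallel. The relation between W'
and W is thus needed only on one pair of blocks. The lemma serves to add the shifts (c = 1), to
replace mixed 𝒯 by Ric/K (f = 0), and to show that a vanishing block has vanishing derivative (c =
0, f = 0). -/
theorem cov_of_eq {W W' : JetPt p n → AIdx p n → AIdx p n → ℝ} {c : ℝ} {f : JetPt p n → ℝ}
    {z : JetPt p n} (hz : z ∈ S.dom) {B A : AIdx p n}
    (hW : DifferentiableAt ℝ (fun w => W w B A) z) (hf : DifferentiableAt ℝ f z)
    (h : ∀ w ∈ S.dom, ∀ B' A', block B' = block B → block A' = block A →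
      W' w B' A' = c * W w B' A' + f w * kron B' A') (C : AIdx p n) :
    S.cov W' C B A z = c * S.cov W C B A z + kron B A * S.D C f z := by
  have h1 : S.D C (fun w => W' w B A) z = c * S.D C (fun w => W w B A) z + kron B A * S.D C f z := by
    rw [S.D_congr (g := fun w => c * W w B A + kron B A * f w)
      (fun w hw => by rw [h w hw B A rfl rfl]; ring) hz, S.D_add (hW.const_mul c) (hf.const_mul _),
      D_const_mul, D_const_mul]
  -- The delta contributes the same term `S.conn B A C z * f z` here and in `h3`; the two enter with
  -- opposite signs and cancel.
  have h2 : ∑ E, S.conn B E C z * W' z E A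
      = c * ∑ E, S.conn B E C z * W z E A + S.conn B A C z * f z := by
    have : S.conn B A C z * f z = ∑ E, S.conn B E C z * (f z * kron E A) := by
      simp [kron]
    rw [this, Finset.mul_sum, ← Finset.sum_add_distrib]
    refine Finset.sum_congr rfl fun E _ => ?_
    by_cases hE : block B = block E
    · rw [h z hz E A hE.symm rfl]; ring
    · rw [S.conn_eq_zero hE]; ring
  have h3 : ∑ E, S.conn E A C z * W' z B E
      = c * ∑ E, S.conn E A C z * W z B E + S.conn B A C z * f z := by
    have : S.conn B A C z * f z = ∑ E, S.conn E A C z * (f z * kron B E) := by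
      simp [kron]
    rw [this, Finset.mul_sum, ← Finset.sum_add_distrib]
    refine Finset.sum_congr rfl fun E _ => ?_
    by_cases hE : block E = block A
    · rw [h z hz B E rfl hE]; ring
    · rw [S.conn_eq_zero hE]; ring
  rw [cov, cov, h1, h2, h3]
  ring

/-! ### Inverse metrics and the block traces of G. -/

theorem h_isUnit_det {z : JetPt p n} (hz : z ∈ S.dom) : IsUnit (S.h z.1).det :=
  (S.metric_h.nondeg _ (dom_U hz)).isUnit

theorem φ_isUnit_det {z : JetPt p n} (hz : z ∈ S.dom) : IsUnit (S.φ z.2.1).det :=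
  (S.metric_φ.nondeg _ (dom_V hz)).isUnit

theorem sum_h_inv_mul {z : JetPt p n} (hz : z ∈ S.dom) (α γ : Fin p) :
    ∑ β, (S.h z.1)⁻¹ α β * S.h z.1 β γ = kron α γ := by
  have := congrFun (congrFun (Matrix.nonsing_inv_mul _ (S.h_isUnit_det hz)) α) γ
  rwa [Matrix.mul_apply, Matrix.one_apply] at this

theorem sum_h_mul_inv {z : JetPt p n} (hz : z ∈ S.dom) (α γ : Fin p) :
    ∑ β, S.h z.1 α β * (S.h z.1)⁻¹ β γ = kron α γ := by
  have := congrFun (congrFun (Matrix.mul_nonsing_inv _ (S.h_isUnit_det hz)) α) γ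
  rwa [Matrix.mul_apply, Matrix.one_apply] at this

theorem sum_φ_inv_mul {z : JetPt p n} (hz : z ∈ S.dom) (i k : Fin n) :
    ∑ j, (S.φ z.2.1)⁻¹ i j * S.φ z.2.1 j k = kron i k := by
  have := congrFun (congrFun (Matrix.nonsing_inv_mul _ (S.φ_isUnit_det hz)) i) k
  rwa [Matrix.mul_apply, Matrix.one_apply] at this

theorem exp_neg_mul_exp (s : ℝ) : Real.exp (-2 * s) * Real.exp (2 * s) = 1 := by
  rw [← Real.exp_add]; simp

theorem sum_Ginv_mul_G {z : JetPt p n} (hz : z ∈ S.dom) (B A : AIdx p n) :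
    ∑ D, S.Ginv z B D * S.G z D A = kron B A := by
  have he := exp_neg_mul_exp (S.σ z)
  rcases eq_or_ne (block B) (block A) with hBA | hBA
  · rcases B with α | i | ⟨i, α⟩ <;> rcases A with γ | k | ⟨k, γ⟩
    all_goals first
      | (exfalso; simp [block] at hBA; done)
      | skip
    · simpa [Fintype.sum_sum_type, Ginv, G, kron] using S.sum_h_inv_mul hz α γ
    · have : ∀ j, Real.exp (-2 * S.σ z) * (S.φ z.2.1)⁻¹ i j * (Real.exp (2 * S.σ z) * S.φ z.2.1 j k)
          = (S.φ z.2.1)⁻¹ i j * S.φ z.2.1 j k := fun j => by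
        linear_combination (S.φ z.2.1)⁻¹ i j * S.φ z.2.1 j k * he
      simp only [Fintype.sum_sum_type, Ginv, G, zero_mul, Finset.sum_const_zero, zero_add, add_zero,
        this, S.sum_φ_inv_mul hz]
      simp [kron]
    · have : ∀ j β, S.h z.1 α β * Real.exp (-2 * S.σ z) * (S.φ z.2.1)⁻¹ i j
            * ((S.h z.1)⁻¹ β γ * Real.exp (2 * S.σ z) * S.φ z.2.1 j k)
          = ((S.φ z.2.1)⁻¹ i j * S.φ z.2.1 j k) * (S.h z.1 α β * (S.h z.1)⁻¹ β γ) := fun j β => by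
        linear_combination ((S.φ z.2.1)⁻¹ i j * S.φ z.2.1 j k)
          * (S.h z.1 α β * (S.h z.1)⁻¹ β γ) * he
      simp only [Fintype.sum_sum_type, Fintype.sum_prod_type, Ginv, G, zero_mul,
        Finset.sum_const_zero, zero_add, this, ← Finset.mul_sum, ← Finset.sum_mul,
        S.sum_φ_inv_mul hz, S.sum_h_mul_inv hz]
      simp [kron, ← ite_and, and_comm]
  · rw [Finset.sum_eq_zero, kron, if_neg fun h => hBA (congrArg block h)]
    intro D _
    rcases eq_or_ne (block B) (block D) with hD | hD
    · rw [S.G_eq_zero (hD ▸ hBA), mul_zero]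
    · rw [S.Ginv_eq_zero hD, zero_mul]

/-- Symmetry of h turns the full contraction into the trace of h⁻¹h; the same device gives the other
two blocks. -/
theorem trT_G {z : JetPt p n} (hz : z ∈ S.dom) : S.trT S.G z = p := by
  have hs := S.metric_h.symm _ (dom_U hz)
  have : ∀ α β, (S.h z.1)⁻¹ α β * S.G z (tI α) (tI β) = (S.h z.1)⁻¹ α β * S.h z.1 β α :=
    fun α β => by rw [G, hs.apply]
  simp [trT, this, S.sum_h_inv_mul hz, kron]

theorem trM_G {z : JetPt p n} (hz : z ∈ S.dom) : S.trM S.G z = n := by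
  have hs := S.metric_φ.symm _ (dom_V hz)
  have : ∀ i j, Real.exp (-2 * S.σ z) * (S.φ z.2.1)⁻¹ i j * S.G z (xI i) (xI j)
      = (S.φ z.2.1)⁻¹ i j * S.φ z.2.1 j i := fun i j => by
    rw [G, hs.apply j i]
    linear_combination (S.φ z.2.1)⁻¹ i j * S.φ z.2.1 j i * exp_neg_mul_exp (S.σ z)
  simp only [trM, this, S.sum_φ_inv_mul hz]
  simp [kron]

theorem trV_G {z : JetPt p n} (hz : z ∈ S.dom) : S.trV S.G z = p * n := by
  have hs := S.metric_φ.symm _ (dom_V hz)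
  have ht := S.metric_h.symm _ (dom_U hz)
  have : ∀ i α j β, S.h z.1 α β * Real.exp (-2 * S.σ z) * (S.φ z.2.1)⁻¹ i j
        * S.G z (vI i α) (vI j β)
      = (S.φ z.2.1)⁻¹ i j * S.φ z.2.1 j i * ((S.h z.1)⁻¹ α β * S.h z.1 β α) := fun i α j β => by
    rw [G, hs.apply j i, ht.apply β α]
    linear_combination (S.φ z.2.1)⁻¹ i j * S.φ z.2.1 j i * ((S.h z.1)⁻¹ α β * S.h z.1 β α)
      * exp_neg_mul_exp (S.σ z)
  simp only [trV, this, ← Finset.mul_sum, ← Finset.sum_mul, S.sum_h_inv_mul hz,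
    S.sum_φ_inv_mul hz]
  simp [kron, mul_comm]

/-! ### The new stress-energy d-tensor -/

/-- The factor of the block of `G` that is added to the stress-energy d-tensor in each block. -/
noncomputable def shift (K : ℝ) (q : Fin 3) (z : JetPt p n) : ℝ :=
  match q with
  | 0 => (S.trM S.Ric z + S.trV S.Ric z) / (2 * K)
  | 1 => (S.trT S.Ric z + S.trV S.Ric z) / (2 * K)
  | 2 => (S.trT S.Ric z + S.trM S.Ric z) / (2 * K)

/-- Reading the factor off the second index is harmless: for mixed components G vanishes. This makes
one formula cover all blocks. -/
theorem newT_eq (K : ℝ) (𝒯 : JetPt p n → AIdx p n → AIdx p n → ℝ) (z : JetPt p n)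
    (A B : AIdx p n) : S.newT K 𝒯 z A B = 𝒯 z A B + S.shift K (block B) z * S.G z A B := by
  rcases A with α | i | ⟨i, α⟩ <;> rcases B with β | j | ⟨j, β⟩ <;>
    simp [newT, G, shift, block]

theorem raise_newT (K : ℝ) (𝒯 : JetPt p n → AIdx p n → AIdx p n → ℝ) {z : JetPt p n}
    (hz : z ∈ S.dom) (B A : AIdx p n) :
    S.raise (S.newT K 𝒯) z B A = 1 * S.raise 𝒯 z B A + S.shift K (block A) z * kron B A := by
  rw [← S.sum_Ginv_mul_G hz, Finset.mul_sum, raise, raise, one_mul, ← Finset.sum_add_distrib]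
  exact Finset.sum_congr rfl fun D _ => by rw [newT_eq]; ring

theorem contDiffOn_shift (K : ℝ) (q : Fin 3) : ContDiffOn ℝ ∞ (S.shift K q) S.dom := by
  fin_cases q
  · exact (S.contDiffOn_trM_Ric.add S.contDiffOn_trV_Ric).div_const _
  · exact (S.contDiffOn_trT_Ric.add S.contDiffOn_trV_Ric).div_const _
  · exact (S.contDiffOn_trT_Ric.add S.contDiffOn_trM_Ric).div_const _

/-! ### Consequences of the Einstein equations. -/

variable {S} {K : ℝ} {𝒯 : JetPt p n → AIdx p n → AIdx p n → ℝ}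

theorem Einstein.stress_eq (hE : S.Einstein K 𝒯) (hK : K ≠ 0) {z : JetPt p n} (hz : z ∈ S.dom)
    (A B : AIdx p n) : 𝒯 z A B = K⁻¹ * (S.Ric z A B - S.Sc z / 2 * S.G z A B) := by
  rw [hE z hz A B, inv_mul_cancel_left₀ hK]

/-- No regularity of 𝒯 is assumed; it is inherited from Ric, Sc and G. -/
theorem Einstein.contDiffOn (hE : S.Einstein K 𝒯) (hK : K ≠ 0) (A B : AIdx p n) :
    ContDiffOn ℝ ∞ (fun z => 𝒯 z A B) S.dom := by
  have hSc : ContDiffOn ℝ ∞ S.Sc S.dom := ContDiffOn.sum fun _ _ => ContDiffOn.sum fun _ _ =>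
    (S.contDiffOn_Ginv _ _).mul (S.contDiffOn_Ric _ _)
  exact (contDiffOn_const.mul ((S.contDiffOn_Ric A B).sub
    ((hSc.div_const 2).mul (S.contDiffOn_G A B)))).congr fun z hz => hE.stress_eq hK hz A B

theorem Einstein.newT_diag (hE : S.Einstein K 𝒯) (hK : K ≠ 0) {z : JetPt p n} (hz : z ∈ S.dom)
    (A B : AIdx p n) : S.newT K 𝒯 z A B
      = K⁻¹ * S.Ric z A B + (S.shift K (block B) z - S.Sc z / (2 * K)) * S.G z A B := by
  rw [newT_eq, hE.stress_eq hK hz]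
  field_simp
  ring

/-- The shift leaves out exactly the block's own part of Sc, so `S.shift K 0 z - S.Sc z / (2 * K)`
is −H/(2K). Against the trace p of the block this gives H/K − pH/(2K). The other two blocks follow
the same pattern with n and pn. -/
theorem Einstein.trT_newT (hE : S.Einstein K 𝒯) (hK : K ≠ 0) {z : JetPt p n} (hz : z ∈ S.dom) :
    S.trT (S.newT K 𝒯) z = -((p - 2) / (2 * K)) * S.trT S.Ric z := by
  have h : S.trT (S.newT K 𝒯) z
      = K⁻¹ * S.trT S.Ric z + (S.shift K 0 z - S.Sc z / (2 * K)) * S.trT S.G z := by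
    simp only [trT, Finset.mul_sum, ← Finset.sum_add_distrib, hE.newT_diag hK hz, block]
    refine Finset.sum_congr rfl fun _ _ => Finset.sum_congr rfl fun _ _ => by ring
  rw [h, S.trT_G hz, shift, S.Sc_eq]
  field_simp
  ring

theorem Einstein.trM_newT (hE : S.Einstein K 𝒯) (hK : K ≠ 0) {z : JetPt p n} (hz : z ∈ S.dom) :
    S.trM (S.newT K 𝒯) z = -((n - 2) / (2 * K)) * S.trM S.Ric z := by
  have h : S.trM (S.newT K 𝒯) z
      = K⁻¹ * S.trM S.Ric z + (S.shift K 1 z - S.Sc z / (2 * K)) * S.trM S.G z := by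
    simp only [trM, Finset.mul_sum, ← Finset.sum_add_distrib, hE.newT_diag hK hz, block]
    refine Finset.sum_congr rfl fun _ _ => Finset.sum_congr rfl fun _ _ => by ring
  rw [h, S.trM_G hz, shift, S.Sc_eq]
  field_simp
  ring

theorem Einstein.trV_newT (hE : S.Einstein K 𝒯) (hK : K ≠ 0) {z : JetPt p n} (hz : z ∈ S.dom) :
    S.trV (S.newT K 𝒯) z = -((p * n - 2) / (2 * K)) * S.trV S.Ric z := by
  have h : S.trV (S.newT K 𝒯) z
      = K⁻¹ * S.trV S.Ric z + (S.shift K 2 z - S.Sc z / (2 * K)) * S.trV S.G z := by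
    simp only [trV, Finset.mul_sum, ← Finset.sum_add_distrib, hE.newT_diag hK hz, block]
    refine Finset.sum_congr rfl fun _ _ => Finset.sum_congr rfl fun _ _ =>
      Finset.sum_congr rfl fun _ _ => Finset.sum_congr rfl fun _ _ => by ring
  rw [h, S.trV_G hz, shift, S.Sc_eq]
  field_simp
  ring

theorem D_of_eq_neg_div {N : ℝ} (hN : N - 2 ≠ 0) {f g : JetPt p n → ℝ}
    (h : ∀ w ∈ S.dom, f w = -((N - 2) / (2 * K)) * g w) {z : JetPt p n} (hz : z ∈ S.dom)
    (A : AIdx p n) : 1 / (N - 2) * S.D A f z = -(1 / (2 * K)) * S.D A g z := by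
  rw [S.D_congr h hz, D_const_mul]
  field_simp

theorem D_add_div {f g : JetPt p n → ℝ} (hf : ContDiffOn ℝ ∞ f S.dom)
    (hg : ContDiffOn ℝ ∞ g S.dom) {z : JetPt p n} (hz : z ∈ S.dom) (A : AIdx p n) :
    S.D A (fun w => (f w + g w) / (2 * K)) z
      = 1 / (2 * K) * S.D A f z + 1 / (2 * K) * S.D A g z := by
  rw [← mul_add, ← S.D_add (differentiableAt_of_contDiffOn hf hz)
    (differentiableAt_of_contDiffOn hg hz), ← D_const_mul]
  congr 1
  funext w
  ring

theorem Einstein.cov_newT (hE : S.Einstein K 𝒯) (hK : K ≠ 0) {z : JetPt p n} (hz : z ∈ S.dom)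
    (B A C : AIdx p n) : S.cov (S.raise (S.newT K 𝒯)) C B A z
      = S.cov (S.raise 𝒯) C B A z + kron B A * S.D C (S.shift K (block A)) z := by
  rw [S.cov_of_eq (W := S.raise 𝒯) (c := 1) (f := S.shift K (block A)) hz, one_mul]
  · exact differentiableAt_of_contDiffOn (S.contDiffOn_raise (hE.contDiffOn hK) B A) hz
  · exact differentiableAt_of_contDiffOn (S.contDiffOn_shift K _) hz
  · intro w hw B' A' _ hA
    rw [S.raise_newT K 𝒯 hw, hA]

/-- Off the diagonal blocks the term (Sc/2) G is absent, and raising with the block diagonal inverse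
keeps the pair of blocks. -/
theorem Einstein.cov_mixed (hE : S.Einstein K 𝒯) (hK : K ≠ 0) {z : JetPt p n} (hz : z ∈ S.dom)
    {B A : AIdx p n} (hBA : block B ≠ block A) (C : AIdx p n) :
    S.cov (S.raise 𝒯) C B A z = 1 / K * S.cov (S.raise S.Ric) C B A z := by
  rw [S.cov_of_eq (W := S.raise S.Ric) (c := 1 / K) (f := fun _ => 0) hz, D_const, mul_zero,
    add_zero]
  · exact differentiableAt_of_contDiffOn (S.contDiffOn_raise S.contDiffOn_Ric B A) hz
  · exact differentiableAt_const _
  · intro w hw B' A' hB hA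
    rw [zero_mul, add_zero, raise, raise, Finset.mul_sum]
    refine Finset.sum_congr rfl fun E _ => ?_
    rcases eq_or_ne (block B') (block E) with h | h
    · rw [hE.stress_eq hK hw, S.G_eq_zero (by rwa [← h, hB, hA])]
      ring
    · rw [S.Ginv_eq_zero h, zero_mul, zero_mul, mul_zero]

/-- The whole block with temporal upper and non-temporal lower index vanishes on the domain, so its
covariant derivative does too. -/
theorem cov_raise_Ric_temporal {z : JetPt p n} (hz : z ∈ S.dom) (μ : Fin p) {A : AIdx p n}
    (hA : block A ≠ 0) (C : AIdx p n) : S.cov (S.raise S.Ric) C (tI μ) A z = 0 := by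
  rw [S.cov_of_eq (W := S.raise S.Ric) (c := 0) (f := fun _ => 0) hz, D_const, mul_zero,
    zero_mul, add_zero]
  · exact differentiableAt_of_contDiffOn (S.contDiffOn_raise S.contDiffOn_Ric _ A) hz
  · exact differentiableAt_const _
  · intro w hw B' A' hB hA'
    rw [zero_mul, zero_mul, add_zero]
    refine Finset.sum_eq_zero fun E _ => ?_
    rcases E with α | E
    · rw [S.Ric_temporal_eq_zero hw α (hA' ▸ hA), mul_zero]
    · rw [S.Ginv_eq_zero, zero_mul]
      rw [hB]
      rcases E with k | ⟨k, γ⟩ <;> simp [block]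

end GRGML

/-! ### The conservation laws for the new stress-energy d-tensor. -/

theorem mainTheorem8 {p n : ℕ} (hp : 2 < p) (hn : 2 < n) (S : GRGML p n) (K : ℝ) (hK : K ≠ 0)
    (𝒯 : JetPt p n → AIdx p n → AIdx p n → ℝ)
    (hE : S.Einstein K 𝒯) (hC : S.Conserved 𝒯) :
    ∀ z ∈ S.dom,
      (∀ β : Fin p,
        ∑ μ, S.cov (S.raise (S.newT K 𝒯)) (tI μ) (tI μ) (tI β) z
          + 1 / ((n : ℝ) - 2) * S.D (tI β) (S.trM (S.newT K 𝒯)) z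
          + 1 / ((p : ℝ) * n - 2) * S.D (tI β) (S.trV (S.newT K 𝒯)) z
        = 1 / K * (-(∑ m, S.cov (S.raise S.Ric) (xI m) (xI m) (tI β) z)
            - ∑ m, ∑ μ, S.cov (S.raise S.Ric) (vI m μ) (vI m μ) (tI β) z)) ∧
      (∀ j : Fin n,
        1 / ((p : ℝ) - 2) * S.D (xI j) (S.trT (S.newT K 𝒯)) z
          + ∑ m, S.cov (S.raise (S.newT K 𝒯)) (xI m) (xI m) (xI j) z
          + 1 / ((p : ℝ) * n - 2) * S.D (xI j) (S.trV (S.newT K 𝒯)) z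
        = 1 / K * -(∑ m, ∑ μ, S.cov (S.raise S.Ric) (vI m μ) (vI m μ) (xI j) z)) ∧
      (∀ (i : Fin n) (α : Fin p),
        1 / ((p : ℝ) - 2) * S.D (vI i α) (S.trT (S.newT K 𝒯)) z
          + 1 / ((n : ℝ) - 2) * S.D (vI i α) (S.trM (S.newT K 𝒯)) z
          + ∑ m, ∑ μ, S.cov (S.raise (S.newT K 𝒯)) (vI m μ) (vI m μ) (vI i α) z
        = 1 / K * -(∑ m, S.cov (S.raise S.Ric) (xI m) (xI m) (vI i α) z)) := by
  intro z hz
  have hp' : (2 : ℝ) < p := by exact_mod_cast hp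
  have hn' : (2 : ℝ) < n := by exact_mod_cast hn
  have hpn' : (2 : ℝ) < p * n := by nlinarith
  have hT := GRGML.D_of_eq_neg_div (sub_pos.2 hp').ne' (fun w hw => hE.trT_newT hK hw) hz
  have hM := GRGML.D_of_eq_neg_div (sub_pos.2 hn').ne' (fun w hw => hE.trM_newT hK hw) hz
  have hV := GRGML.D_of_eq_neg_div (sub_pos.2 hpn').ne' (fun w hw => hE.trV_newT hK hw) hz
  have cT := S.contDiffOn_trT_Ric
  have cM := S.contDiffOn_trM_Ric
  have cV := S.contDiffOn_trV_Ric
  have hC' := fun A => hC z hz A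
  simp only [Fintype.sum_sum_type, Fintype.sum_prod_type] at hC'
  have hmix := fun (B A : AIdx p n) (h : GRGML.block B ≠ GRGML.block A) C => hE.cov_mixed hK hz h C
  refine ⟨fun β => ?_, fun j => ?_, fun i α => ?_⟩
  · have h := hC' (tI β)
    simp only [hmix (xI _) (tI β) (by simp [GRGML.block]),
      hmix (vI _ _) (tI β) (by simp [GRGML.block]), ← Finset.mul_sum] at h
    -- Contracting the delta on the diagonal leaves a single gradient, with no factor p, because the
    -- derivative index is contracted too.
    have hd : ∑ μ, S.cov (S.raise (S.newT K 𝒯)) (tI μ) (tI μ) (tI β) z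
        = ∑ μ, S.cov (S.raise 𝒯) (tI μ) (tI μ) (tI β) z
          + S.D (tI β) (fun w => (S.trM S.Ric w + S.trV S.Ric w) / (2 * K)) z := by
      simp only [hE.cov_newT hK hz, Finset.sum_add_distrib]
      simp [kron, GRGML.block]
      rfl
    rw [hM, hV, hd, GRGML.D_add_div cM cV hz]
    -- The gradients of R and S now occur with coefficients 1/(2K) and −1/(2K) and cancel; what is
    -- left is the conservation law.
    linear_combination h
  · have h := hC' (xI j)
    simp only [hmix (tI _) (xI j) (by simp [GRGML.block]),
      GRGML.cov_raise_Ric_temporal (A := xI j) hz _ (by simp [GRGML.block]),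
      hmix (vI _ _) (xI j) (by simp [GRGML.block]), ← Finset.mul_sum] at h
    have hd : ∑ m, S.cov (S.raise (S.newT K 𝒯)) (xI m) (xI m) (xI j) z
        = ∑ m, S.cov (S.raise 𝒯) (xI m) (xI m) (xI j) z
          + S.D (xI j) (fun w => (S.trT S.Ric w + S.trV S.Ric w) / (2 * K)) z := by
      simp only [hE.cov_newT hK hz, Finset.sum_add_distrib]
      simp [kron, GRGML.block]
      rfl
    rw [hT, hV, hd, GRGML.D_add_div cT cV hz]
    simp only [Finset.sum_const_zero] at h
    linear_combination h
  · have h := hC' (vI i α)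
    simp only [hmix (tI _) (vI i α) (by simp [GRGML.block]),
      GRGML.cov_raise_Ric_temporal (A := vI i α) hz _ (by simp [GRGML.block]),
      hmix (xI _) (vI i α) (by simp [GRGML.block]), ← Finset.mul_sum] at h
    have hd : ∑ m, ∑ μ, S.cov (S.raise (S.newT K 𝒯)) (vI m μ) (vI m μ) (vI i α) z
        = ∑ m, ∑ μ, S.cov (S.raise 𝒯) (vI m μ) (vI m μ) (vI i α) z
          + S.D (vI i α) (fun w => (S.trT S.Ric w + S.trM S.Ric w) / (2 * K)) z := by
      simp only [hE.cov_newT hK hz, Finset.sum_add_distrib]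
      simp [kron, GRGML.block, ite_and]
      rfl
    rw [hT, hM, hd, GRGML.D_add_div cT cM hz]
    simp only [Finset.sum_const_zero] at h
    linear_combination h
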